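/- Let $f:\mathbb{R}^2\to\mathbb{R}$ be a polynomial function with $f(0,0)=0$ that has a strict local minimum at the origin, and let $\varepsilon>0$. Let $\mathcal{D}_\varepsilon$ be the connected component of $f^{-1}([0,\varepsilon])$ that contains the origin, and let $\mathcal{C}_\varepsilon=\mathcal{D}_\varepsilon\setminus\operatorname{Int}\mathcal{D}_\varepsilon$. A line $L$ is said to be tangent to $\mathcal{C}_\varepsilon$ at $P\in\mathcal{C}_\varepsilon$ if it passes through $P$ and its direction is the limit of the directions of secants $PQ_n$, with $Q_n\in\mathcal{C}_\varepsilon\setminus\{P\}$, $Q_n\to P$ (the usual tangent where $\mathcal{C}_\varepsilon$ is smooth). A bitangent is a line that is tangent to $\mathcal{C}_\varepsilon$ at two distinct points. An inflection point is a point of $\mathcal{C}_\varepsilon$ through which $\mathcal{C}_\varepsilon$ contains a regular $C^2$ arc whose curvature vanishes at that point. A direction $d\in\mathbb{RP}^1$ is generic with respect to $\mathcal{C}_\varepsilon$ if it is neither the direction of a bitangent of $\mathcal{C}_\varepsilon$ nor the direction of a tangent to $\mathcal{C}_\varepsilon$ at an inflection point of $\mathcal{C}_\varepsilon$. Then all but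 finitely many directions $d\in\mathbb{RP}^1$ are generic with respect to $\mathcal{C}_\varepsilon$. -/

import Mathlib

open scoped Topology

noncomputable section

/-- The real affine plane. -/
abbrev Plane : Type := EuclideanSpace ℝ (Fin 2)

/-- The polynomial function on the plane defined by a polynomial in two variables. -/
def polyFun (f : MvPolynomial (Fin 2) ℝ) (p : Plane) : ℝ :=
  MvPolynomial.eval (fun i => p i) f

/-- `f` has a strict local minimum at the origin. -/
def HasStrictLocalMinAtOrigin (f : MvPolynomial (Fin 2) ℝ) : Prop :=
  ∀ᶠ p in 𝓝[≠] (0 : Plane), polyFun f 0 < polyFun f p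

/-- `𝒟_ε`: the connected component containing the origin of `f⁻¹([0, ε])`. -/
def sublevelComponent (f : MvPolynomial (Fin 2) ℝ) (ε : ℝ) : Set Plane :=
  connectedComponentIn (polyFun f ⁻¹' Set.Icc 0 ε) 0

/-- `𝒞_ε = 𝒟_ε \ Int 𝒟_ε`. -/
def levelCurve (f : MvPolynomial (Fin 2) ℝ) (ε : ℝ) : Set Plane :=
  sublevelComponent f ε \ interior (sublevelComponent f ε)

/-- The line `L` is tangent to the set `C` at the point `P ∈ C`: it passes through `P`, and its
direction is a limit of directions of secants `PQ` with `Q ∈ C`, `Q → P`. At a point where `C` is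
a regular arc this is the usual tangent; at a singular point it gives the tangents to
the branches of `C`. -/
def IsTangentLineAt (C : Set Plane) (P : Plane) (L : AffineSubspace ℝ Plane) : Prop :=
  P ∈ C ∧ ∃ v ∈ tangentConeAt ℝ C P, v ≠ 0 ∧ L = AffineSubspace.mk' P (ℝ ∙ v)

/-- A bitangent of `C`: a line that is tangent to `C` at two distinct points. -/
def IsBitangent (C : Set Plane) (L : AffineSubspace ℝ Plane) : Prop :=
  ∃ P Q : Plane, P ≠ Q ∧ IsTangentLineAt C P L ∧ IsTangentLineAt C Q L

/-- An inflection point of `C`: a point `P` through which `C` contains a regular arc of class `C²`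
with zero curvature at `P` (the arc has contact of order at least three with its tangent). -/
def IsInflectionPoint (C : Set Plane) (P : Plane) : Prop :=
  ∃ γ : ℝ → Plane, ContDiffAt ℝ 2 γ 0 ∧ γ 0 = P ∧ (∀ᶠ t in 𝓝 (0 : ℝ), γ t ∈ C) ∧
    deriv γ 0 ≠ 0 ∧ ∃ c : ℝ, deriv (deriv γ) 0 = c • deriv γ 0

/-- A direction is a point of the real projective line, i.e. a line through `0` in `ℝ²`. -/
abbrev ProjDirection : Type := Projectivization ℝ Plane

/-- The direction `d` is generic with respect to `C`: it is neither the direction of a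
bitangent of `C`, nor the direction of a tangent to `C` at an inflection point of `C`. -/
def IsGenericDirection (C : Set Plane) (d : ProjDirection) : Prop :=
  (∀ L : AffineSubspace ℝ Plane, IsBitangent C L → L.direction ≠ d.submodule) ∧
  (∀ (P : Plane) (L : AffineSubspace ℝ Plane), IsInflectionPoint C P → IsTangentLineAt C P L →
    L.direction ≠ d.submodule)

end

/-!
The level curve lies in the zero set of the nonzero polynomial `g = f (f - ε)`, since a point of
`𝒟_ε` where `0 < f < ε` is interior. Nothing else about it matters: the finiteness holds for every
subset `C` of a real algebraic curve (`finite_not_isGenericDirection`).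

Suppose infinitely many slopes `m n` are bad, and let `P n` be points of tangency. In the field `K` of
germs of real sequences at a nonprincipal ultrafilter, the germ `m` is transcendental over `ℝ`, hence
there is an `ℝ`-derivation `D` of `K` with `D m = 1` (`exists_germ_field_derivation`). The germ
`(x, y)` of `P n` is a point of the curve over `K`, and the fact that `(1, m)` is a tangent direction
says that the leading form of `g` at `(x, y)` vanishes on `(1, m)`. Applying `D` to the Taylor
coefficients of `g` in the coordinates `S`, `U` with `(X, Y) = (x + S, y + m S + U)` gives a recursion
(`derivation_taylorCoeff`), from which `D y = m * D x` and `D x ≠ 0`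
(`derivation_eq_mul_and_ne_zero`): the point moves along its tangent. Singular points and multiple
components need no separate treatment.

If the line `Y = m X + b` is tangent at two points, then `D b = D (y - m * x) = -x` for both of them,
so that their germs coincide, and the points are equal for some `n`.

For inflection points, let `k` be the multiplicity of `g` at `(x, y)`. The same recursion shows that,
with weights `1` for `S` and `2` for `U`, the expansion of `g` starts in weight `2 k` with nonzero
coefficients at `U ^ k` and `S ^ (2 k)` (`taylorCoeff_of_derivation_eq_mul`). This passes to `P n` for
some `n`, and is incompatible with a `C²` arc of zero curvature in the zero set
(`not_isInflectionPoint_of_taylorCoeff`).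
-/

noncomputable section

open Polynomial Filter

/-! ### Derivations of transcendental field extensions -/

/-- A transcendental element can be put into a transcendence basis `s`; the partial derivative with
respect to it on the polynomial ring `k[s]` extends to `K`, because `K` is formally étale over
`k[s]` (a localization followed by a separable algebraic extension). -/
theorem exists_derivation_eq_one_of_transcendental {k K : Type} [Field k] [CharZero k] [Field K]
    [Algebra k K] {m : K} (hm : Transcendental k m) : ∃ D : Derivation k K K, D m = 1 := by
  classical
  have hm' : AlgebraicIndepOn k id ({m} : Set K) := by
    have : AlgebraicIndependent k (fun i : ({m} : Set K) => (i : K)) := by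
      rw [algebraicIndependent_unique_type_iff]
      exact hm
    exact this
  obtain ⟨s, hms, hs⟩ := exists_isTranscendenceBasis_superset hm'
  let v : s → K := fun i => i
  let A := MvPolynomial s k
  let : Algebra A K := (MvPolynomial.aeval v).toAlgebra
  have : IsScalarTower k A K := IsScalarTower.of_algebraMap_eq fun r => by
    rw [RingHom.algebraMap_toAlgebra]
    exact ((MvPolynomial.aeval v).commutes r).symm
  have hmap : ∀ i : s, algebraMap A K (MvPolynomial.X i) = i := fun i => by
    rw [RingHom.algebraMap_toAlgebra]
    exact MvPolynomial.aeval_X v i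
  have : FaithfulSMul A K := (faithfulSMul_iff_algebraMap_injective A K).2 hs.1
  have : Algebra.IsAlgebraic A K := (hs.isAlgebraic_iff (S := A)).2 fun i => by
    rw [← hmap i]
    exact isAlgebraic_algebraMap _
  let := FractionRing.liftAlgebra A K
  have : Algebra.IsAlgebraic (FractionRing A) K :=
    Algebra.IsAlgebraic.extendScalars (R := A) (FaithfulSMul.algebraMap_injective A _)
  have : CharZero (FractionRing A) := charZero_of_injective_algebraMap
    (FaithfulSMul.algebraMap_injective k (FractionRing A))
  have : Algebra.FormallyEtale A (FractionRing A) :=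
    Algebra.FormallyEtale.of_isLocalization (nonZeroDivisors A)
  have : Algebra.FormallyEtale (FractionRing A) K := Algebra.FormallyEtale.of_isSeparable _ K
  have : Algebra.FormallyEtale A K := Algebra.FormallyEtale.comp A (FractionRing A) K
  let d : Derivation k A K := MvPolynomial.mkDerivation k (fun i : s => if (i : K) = m then 1 else 0)
  let e := KaehlerDifferential.tensorKaehlerEquivOfFormallyEtale k A K
  let φ : Ω[K⁄k] →ₗ[K] K := (LinearMap.liftBaseChange K d.liftKaehlerDifferential) ∘ₗ e.symm.toLinearMap
  refine ⟨φ.compDer (KaehlerDifferential.D k K), ?_⟩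
  have hm2 : algebraMap A K (MvPolynomial.X ⟨m, hms rfl⟩) = m := hmap _
  change φ (KaehlerDifferential.D k K m) = 1
  conv_lhs => rw [← hm2]
  change (LinearMap.liftBaseChange K d.liftKaehlerDifferential) (e.symm _) = 1
  rw [KaehlerDifferential.tensorKaehlerEquivOfFormallyEtale_symm_D_algebraMap]
  simp only [LinearMap.liftBaseChange_tmul, Derivation.liftKaehlerDifferential_comp_D, one_smul, d]
  rw [MvPolynomial.mkDerivation_X, if_pos rfl]

/-! ### Taylor coefficients in sheared coordinates -/

section
variable {A B : Type*} [CommRing A] [Algebra ℝ A] [CommRing B] [Algebra ℝ B]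

/-- The derivation of `A[X]` that applies `D` to every coefficient. -/
def coeffDerivation (D : Derivation ℝ A A) : Derivation ℝ A[X] A[X] :=
  PolynomialModule.equivPolynomialSelf.toLinearMap.compDer D.mapCoeffs

@[simp]
theorem coeff_coeffDerivation (D : Derivation ℝ A A) (p : A[X]) (i : ℕ) :
    (coeffDerivation D p).coeff i = D (p.coeff i) := rfl

/-- The formal derivative of `A[X]`, as an `ℝ`-linear derivation. -/
def formalDeriv (A : Type*) [CommRing A] [Algebra ℝ A] : Derivation ℝ A[X] A[X] :=
  Polynomial.derivative'.restrictScalars ℝ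

@[simp]
theorem formalDeriv_apply (p : A[X]) : formalDeriv A p = derivative p := rfl

/-- The expansion `g (x + S, y + m S + U)` of `g` at the point `(x, y)` in the sheared coordinates
`S` along the direction `(1, m)` and `U` along `(0, 1)`. The inner variable of `A[X][X]` is `S`, the
outer one is `U`. -/
def shearedExpansion (g : MvPolynomial (Fin 2) ℝ) (x y m : A) : A[X][X] :=
  MvPolynomial.aeval ![C (C x + X), C (C y + C m * X) + X] g

/-- The coefficient of `S ^ i * U ^ j` in `g (x + S, y + m S + U)`. -/
def taylorCoeff (g : MvPolynomial (Fin 2) ℝ) (x y m : A) (i j : ℕ) : A :=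
  ((shearedExpansion g x y m).coeff j).coeff i

theorem taylorCoeff_map (φ : A →ₐ[ℝ] B) (g : MvPolynomial (Fin 2) ℝ) (x y m : A) (i j : ℕ) :
    taylorCoeff g (φ x) (φ y) (φ m) i j = φ (taylorCoeff g x y m i j) := by
  have h : shearedExpansion g (φ x) (φ y) (φ m) =
      mapAlgHom (mapAlgHom φ) (shearedExpansion g x y m) := by
    unfold shearedExpansion
    rw [← AlgHom.comp_apply, MvPolynomial.comp_aeval]
    congr 2
    funext l
    fin_cases l <;> simp
  simp [taylorCoeff, h]

theorem eval_eval_shearedExpansion (g : MvPolynomial (Fin 2) ℝ) (x y m s u : A) :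
    ((shearedExpansion g x y m).eval (C u)).eval s =
      MvPolynomial.aeval ![x + s, y + m * s + u] g := by
  have h : ∀ p : A[X][X], (p.eval (C u)).eval s =
      ((aeval (R := A) s).restrictScalars ℝ).comp
        ((aeval (R := A[X]) (C u : A[X])).restrictScalars ℝ) p := fun p => by
    simp [Polynomial.coe_aeval_eq_eval]
  rw [h, shearedExpansion, ← AlgHom.comp_apply, MvPolynomial.comp_aeval]
  congr 2
  funext l
  fin_cases l <;> simp

theorem exists_taylorCoeff_ne_zero [Nontrivial A] {g : MvPolynomial (Fin 2) ℝ} (hg : g ≠ 0)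
    (x y m : A) : ∃ i j, taylorCoeff g x y m i j ≠ 0 := by
  by_contra! h
  have h0 : shearedExpansion g x y m = 0 := by
    ext j i
    exact h i j
  -- The expansion takes every value that `g` takes at a real point.
  obtain ⟨v, hv⟩ : ∃ v : Fin 2 → ℝ, MvPolynomial.eval v g ≠ 0 := by
    by_contra! hz
    exact hg (MvPolynomial.funext fun v => by simpa using hz v)
  have h1 := eval_eval_shearedExpansion g x y m (algebraMap ℝ A (v 0) - x)
    (algebraMap ℝ A (v 1) - (y + m * (algebraMap ℝ A (v 0) - x)))
  have h2 : (![x + (algebraMap ℝ A (v 0) - x), y + m * (algebraMap ℝ A (v 0) - x) +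
      (algebraMap ℝ A (v 1) - (y + m * (algebraMap ℝ A (v 0) - x)))] : Fin 2 → A) =
      fun l => algebraMap ℝ A (v l) := by
    funext l
    fin_cases l <;> simp
  have h3 : MvPolynomial.aeval (fun l => algebraMap ℝ A (v l)) g =
      algebraMap ℝ A (MvPolynomial.eval v g) := by
    rw [← MvPolynomial.aeval_eq_eval]
    exact MvPolynomial.aeval_algebraMap_apply A v g
  rw [h0, h2, h3] at h1
  apply hv
  simpa using h1.symm

/-- The chain rule: moving the base point `(x, y)` and the slope `m` along `D` changes the expansion
by a combination of its `S`- and `U`-derivatives. -/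
theorem derivation_shearedExpansion (D : Derivation ℝ A A) (g : MvPolynomial (Fin 2) ℝ)
    {x y m : A} (hm : D m = 1) :
    coeffDerivation (coeffDerivation D) (shearedExpansion g x y m) =
      C (C (D x)) * coeffDerivation (formalDeriv A) (shearedExpansion g x y m) +
      C (C (D y - m * D x) + X) * formalDeriv A[X] (shearedExpansion g x y m) := by
  -- Both sides are derivations, so it is enough to compare them on the two generators.
  let D' : Derivation ℝ A[X][X] A[X][X] :=
    C (C (D x)) • coeffDerivation (formalDeriv A) + C (C (D y - m * D x) + X) • formalDeriv A[X]
  have hC : ∀ (E : Derivation ℝ A A) (a : A), coeffDerivation E (C a) = C (E a) := fun E a => by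
    ext i; simp [coeff_C, apply_ite E]
  have hCC : ∀ (E : Derivation ℝ A[X] A[X]) (a : A[X]), coeffDerivation E (C a) = C (E a) :=
    fun E a => by ext1 i; simp [coeff_C, apply_ite E]
  have hX : ∀ (E : Derivation ℝ A A), coeffDerivation E X = 0 := fun E => by
    ext i; simp [coeff_X, apply_ite E]
  have hXX : ∀ (E : Derivation ℝ A[X] A[X]), coeffDerivation E X = 0 := fun E => by
    ext1 i; simp [coeff_X, apply_ite E]
  have key : Set.EqOn (coeffDerivation (coeffDerivation D)) D'
      (Algebra.adjoin ℝ (Set.range ![C (C x + X), C (C y + C m * X) + X])) := by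
    apply Derivation.eqOn_adjoin
    rintro _ ⟨l, rfl⟩
    fin_cases l
    · simp [D', hC, hCC, hX]
    · simp [D', hC, hCC, hX, hXX, hm]
      ring
  have hmem : shearedExpansion g x y m ∈
      Algebra.adjoin ℝ (Set.range ![C (C x + X), C (C y + C m * X) + X]) := by
    rw [Algebra.adjoin_range_eq_range_aeval]
    exact ⟨g, rfl⟩
  exact key hmem

/-- The recursion on Taylor coefficients that drives the whole argument. -/
theorem derivation_taylorCoeff (D : Derivation ℝ A A) (g : MvPolynomial (Fin 2) ℝ)
    {x y m : A} (hm : D m = 1) (i j : ℕ) :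
    D (taylorCoeff g x y m i j) = (i + 1) * D x * taylorCoeff g x y m (i + 1) j +
      (j + 1) * (D y - m * D x) * taylorCoeff g x y m i (j + 1) +
      (j + 1) * (if i = 0 then 0 else taylorCoeff g x y m (i - 1) (j + 1)) := by
  have h := congrArg (fun p => (p.coeff j).coeff i)
    (derivation_shearedExpansion D g (x := x) (y := y) hm)
  simp only [coeff_coeffDerivation, coeff_add, coeff_C_mul, formalDeriv_apply, coeff_derivative,
    add_mul] at h
  have e : ((j : A[X]) + 1) = C ((j : A) + 1) := by simp
  rw [e] at h
  unfold taylorCoeff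
  rw [h]
  rcases i with _ | i <;> simp [coeff_X_mul, mul_add] <;> ring
end

/-! ### Consequences of the recursion over a field with a derivation -/

section
variable {K : Type*} [Field K] [Algebra ℝ K] {g : MvPolynomial (Fin 2) ℝ}
  {x y m : K} {k : ℕ} {D : Derivation ℝ K K}

/-- Let `k` be the order of vanishing of `g` at `(x, y)`. If the leading form at `(x, y)` vanishes in
the direction `(1, m)` and `D m = 1`, then the point moves along `D`, in the direction
`(1, m)`: otherwise the recursion spreads the vanishing of the coefficient at `(k, 0)` to the whole
leading form. -/
theorem derivation_eq_mul_and_ne_zero (hm : D m = 1)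
    (hvan : ∀ i j, i + j < k → taylorCoeff g x y m i j = 0)
    (hk : taylorCoeff g x y m k 0 = 0)
    (hne : ∃ i j, i + j = k ∧ taylorCoeff g x y m i j ≠ 0) :
    D y = m * D x ∧ D x ≠ 0 := by
  have : CharZero K := charZero_of_injective_algebraMap (algebraMap ℝ K).injective
  obtain ⟨i₀, j₀, hij, h₀⟩ := hne
  have hw : D y - m * D x = 0 := by
    by_contra hw
    have key : ∀ j i, i + j = k → taylorCoeff g x y m i j = 0 := by
      intro j
      induction j with
      | zero => rintro i rfl; exact hk
      | succ j ih =>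
        intro i hi
        have h := derivation_taylorCoeff D g (x := x) (y := y) hm i j
        have h1 : (if i = 0 then 0 else taylorCoeff g x y m (i - 1) (j + 1)) = 0 := by
          split_ifs
          · rfl
          · exact hvan _ _ (by omega)
        rw [hvan i j (by omega), ih (i + 1) (by omega), h1, map_zero] at h
        have h2 : ((j : K) + 1) * (D y - m * D x) ≠ 0 := mul_ne_zero (Nat.cast_add_one_ne_zero j) hw
        simpa [h2] using h.symm
    exact h₀ (key _ _ hij)
  refine ⟨sub_eq_zero.1 hw, fun hx => ?_⟩
  have key : ∀ j i, i + j = k → taylorCoeff g x y m i j = 0 := by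
    intro j
    induction j with
    | zero => rintro i rfl; exact hk
    | succ j ih =>
      intro i hi
      have h := derivation_taylorCoeff D g (x := x) (y := y) hm (i + 1) j
      rw [ih (i + 1) (by omega), hw, hx, map_zero] at h
      have h2 : ((j : K) + 1) ≠ 0 := Nat.cast_add_one_ne_zero j
      simpa [h2] using h.symm
  exact h₀ (key _ _ hij)

/-- If the point moves in the direction `(1, m)` and `D m = 1`, then for the weights `1` of `S` and
`2` of `U` the expansion starts in weight `2 k`, and its part of that weight contains both `U ^ k`
and `S ^ (2 k)`: like the `k`-th power of a curve with nonzero curvature. -/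
theorem taylorCoeff_of_derivation_eq_mul (hm : D m = 1) (hy : D y = m * D x) (hx : D x ≠ 0)
    (hvan : ∀ i j, i + j < k → taylorCoeff g x y m i j = 0)
    (hne : ∃ i j, i + j = k ∧ taylorCoeff g x y m i j ≠ 0) :
    taylorCoeff g x y m 0 k ≠ 0 ∧ (∀ i j, i + 2 * j < 2 * k → taylorCoeff g x y m i j = 0) ∧
      taylorCoeff g x y m (2 * k) 0 ≠ 0 := by
  have : CharZero K := charZero_of_injective_algebraMap (algebraMap ℝ K).injective
  have hrec : ∀ i j, D (taylorCoeff g x y m i j) = (i + 1) * D x * taylorCoeff g x y m (i + 1) j +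
      (j + 1) * (if i = 0 then 0 else taylorCoeff g x y m (i - 1) (j + 1)) := fun i j => by
    rw [derivation_taylorCoeff D g hm i j, hy]
    ring
  have hcoef : ∀ i : ℕ, ((i : K) + 1) * D x ≠ 0 := fun i => mul_ne_zero (Nat.cast_add_one_ne_zero i) hx
  have h2 : ∀ i j, i + 2 * j < 2 * k → taylorCoeff g x y m i j = 0 := by
    intro i
    induction i using Nat.strong_induction_on with
    | _ i ih =>
      intro j hij
      rcases i with _ | i
      · exact hvan _ _ (by omega)
      · have h := hrec i j
        have h1 : (if i = 0 then 0 else taylorCoeff g x y m (i - 1) (j + 1)) = 0 := by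
          split_ifs
          · rfl
          · exact ih _ (by omega) _ (by omega)
        rw [ih i (by omega) j (by omega), h1, map_zero] at h
        simpa [hcoef i] using h.symm
  have h1 : taylorCoeff g x y m 0 k ≠ 0 := by
    obtain ⟨i, j, hij, h⟩ := hne
    rcases Nat.eq_zero_or_pos i with rfl | hi
    · rwa [← hij, zero_add]
    · exact absurd (h2 i j (by omega)) h
  -- In weight `2 k` the recursion passes from `(2 l, j + 1)` to `(2 (l + 1), j)`.
  have h3 : ∀ l j, l + j = k → taylorCoeff g x y m (2 * l) j ≠ 0 := by
    intro l
    induction l with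
    | zero => rintro j rfl; simpa using h1
    | succ l ih =>
      intro j hj h0
      have h := hrec (2 * l + 1) j
      rw [h2 (2 * l + 1) j (by omega), show 2 * l + 1 + 1 = 2 * (l + 1) by ring, h0, map_zero] at h
      have hj1 : ((j : K) + 1) ≠ 0 := Nat.cast_add_one_ne_zero j
      exact ih (j + 1) (by omega) (by simpa [hj1] using h.symm)
  exact ⟨h1, h2, h3 k 0 (by omega)⟩
end

/-- Points of the zero set with coordinates `s`, `u` such that `s / t → α` and `u / t ^ e → β` as
`t → 0` force the leading
part of the expansion, for the weights `1` of `S` and `e` of `U`, to vanish at `(α, β)`. Here this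
leading part is assumed to reduce to a single monomial at `(α, β)`. -/
theorem taylorCoeff_mul_pow_eq_zero_of_tendsto {ι : Type*} {l : Filter ι} [l.NeBot]
    {g : MvPolynomial (Fin 2) ℝ} {x y m α β : ℝ} {e N i₀ j₀ : ℕ} {t s u : ι → ℝ}
    (ht : Tendsto t l (𝓝 0)) (ht0 : ∀ᶠ n in l, t n ≠ 0)
    (hs : Tendsto (fun n => s n / t n) l (𝓝 α)) (hu : Tendsto (fun n => u n / t n ^ e) l (𝓝 β))
    (hzero : ∀ᶠ n in l, MvPolynomial.aeval ![x + s n, y + m * s n + u n] g = (0 : ℝ))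
    (hvan : ∀ i j, i + e * j < N → taylorCoeff g x y m i j = 0) (hN : i₀ + e * j₀ = N)
    (hother : ∀ i j, i + e * j = N → (j, i) ≠ (j₀, i₀) →
      taylorCoeff g x y m i j * α ^ i * β ^ j = 0) :
    taylorCoeff g x y m i₀ j₀ * α ^ i₀ * β ^ j₀ = 0 := by
  classical
  set T := shearedExpansion g x y m with hT
  set J := max (T.natDegree + 1) (j₀ + 1) with hJ
  set I := max ((Finset.range J).sup (fun j => (T.coeff j).natDegree) + 1) (i₀ + 1) with hI
  have hsum : ∀ s u : ℝ, MvPolynomial.aeval ![x + s, y + m * s + u] g =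
      ∑ p ∈ Finset.range J ×ˢ Finset.range I, taylorCoeff g x y m p.2 p.1 * s ^ p.2 * u ^ p.1 := by
    intro s u
    rw [← eval_eval_shearedExpansion, ← hT,
      Polynomial.eval_eq_sum_range' (p := T) (n := J) (by omega), Polynomial.eval_finsetSum,
      Finset.sum_product]
    refine Finset.sum_congr rfl fun j hj => ?_
    have hdeg : (T.coeff j).natDegree < I := by
      have := Finset.le_sup (f := fun j => (T.coeff j).natDegree) hj
      omega
    rw [Polynomial.eval_mul, Polynomial.eval_eq_sum_range' hdeg, Finset.sum_mul]
    simp [taylorCoeff, hT]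
  -- The expansion divided by `t ^ N`. Terms of weight below `N` have zero coefficients, so the
  -- truncated subtraction in the exponent is harmless.
  have hlim : Tendsto (fun n => ∑ p ∈ Finset.range J ×ˢ Finset.range I,
      taylorCoeff g x y m p.2 p.1 * t n ^ (p.2 + e * p.1 - N) *
        (s n / t n) ^ p.2 * (u n / t n ^ e) ^ p.1) l
      (𝓝 (∑ p ∈ Finset.range J ×ˢ Finset.range I,
        taylorCoeff g x y m p.2 p.1 * 0 ^ (p.2 + e * p.1 - N) * α ^ p.2 * β ^ p.1)) :=
    tendsto_finsetSum _ fun p _ => (((ht.pow _).const_mul _).mul (hs.pow _)).mul (hu.pow _)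
  have hev : ∀ᶠ n in l, ∑ p ∈ Finset.range J ×ˢ Finset.range I,
      taylorCoeff g x y m p.2 p.1 * t n ^ (p.2 + e * p.1 - N) *
        (s n / t n) ^ p.2 * (u n / t n ^ e) ^ p.1 = 0 := by
    filter_upwards [ht0, hzero] with n hn hz
    have : t n ^ N * ∑ p ∈ Finset.range J ×ˢ Finset.range I,
      taylorCoeff g x y m p.2 p.1 * t n ^ (p.2 + e * p.1 - N) *
        (s n / t n) ^ p.2 * (u n / t n ^ e) ^ p.1 = 0 := by
      rw [← hz, hsum, Finset.mul_sum]
      refine Finset.sum_congr rfl fun p _ => ?_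
      rcases lt_or_ge (p.2 + e * p.1) N with h | h
      · simp [hvan _ _ h]
      · have h1 : t n ^ N * t n ^ (p.2 + e * p.1 - N) = t n ^ p.2 * (t n ^ e) ^ p.1 := by
          rw [← pow_add, ← pow_mul, ← pow_add]
          congr 1
          omega
        calc _ = taylorCoeff g x y m p.2 p.1 * (t n ^ N * t n ^ (p.2 + e * p.1 - N)) *
              (s n / t n) ^ p.2 * (u n / t n ^ e) ^ p.1 := by ring
          _ = taylorCoeff g x y m p.2 p.1 * (t n * (s n / t n)) ^ p.2 *
              (t n ^ e * (u n / t n ^ e)) ^ p.1 := by rw [h1]; ring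
          _ = _ := by rw [mul_div_cancel₀ _ hn, mul_div_cancel₀ _ (pow_ne_zero _ hn)]
    exact (mul_eq_zero.1 this).resolve_left (pow_ne_zero _ hn)
  have h0 := tendsto_nhds_unique (hlim.congr' hev) tendsto_const_nhds
  rw [Finset.sum_eq_single (j₀, i₀)] at h0
  · simpa [hN] using h0
  · rintro ⟨j, i⟩ - hne
    rcases lt_trichotomy (i + e * j) N with h | h | h
    · simp [hvan _ _ h]
    · simpa [h] using hother i j h hne
    · simp [show i + e * j - N ≠ 0 by omega]
  · intro hmem
    exact absurd (Finset.mem_product.2 ⟨Finset.mem_range.2 (by simp only; omega),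
      Finset.mem_range.2 (by simp only; omega)⟩) hmem

/-! ### Tangent directions and inflection points of a real zero set -/

theorem polyFun_eq_aeval (g : MvPolynomial (Fin 2) ℝ) (p : Plane) :
    polyFun g p = MvPolynomial.aeval ![p 0, p 1] g := by
  have : (![p 0, p 1] : Fin 2 → ℝ) = fun i => p i := by
    funext i
    fin_cases i <;> rfl
  rw [this, MvPolynomial.aeval_eq_eval]
  rfl

/-- The leading form of `g` at a point of a subset `C` of its zero set vanishes on the tangent
directions of `C`. -/
theorem taylorCoeff_eq_zero_of_mem_tangentConeAt {g : MvPolynomial (Fin 2) ℝ} {C : Set Plane}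
    (hC : ∀ p ∈ C, polyFun g p = 0) {P : Plane} {m : ℝ} (hv : !₂[1, m] ∈ tangentConeAt ℝ C P)
    {k : ℕ} (hvan : ∀ i j, i + j < k → taylorCoeff g (P 0) (P 1) m i j = 0) :
    taylorCoeff g (P 0) (P 1) m k 0 = 0 := by
  obtain ⟨α, l, hl, c, d, hd, hmem, hcd⟩ := exists_fun_of_mem_tangentConeAt hv
  have hcoord : ∀ i : Fin 2, Continuous fun p : Plane => p i := fun i => by fun_prop
  have hd0 : Tendsto (fun n => d n 0) l (𝓝 0) := by
    simpa [Function.comp_def] using ((hcoord 0).tendsto 0).comp hd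
  have h0 : Tendsto (fun n => c n * d n 0) l (𝓝 1) := by
    simpa [Function.comp_def] using ((hcoord 0).tendsto _).comp hcd
  have h1 : Tendsto (fun n => c n * d n 1) l (𝓝 m) := by
    simpa [Function.comp_def] using ((hcoord 1).tendsto _).comp hcd
  have hc : ∀ᶠ n in l, c n ≠ 0 := by
    filter_upwards [h0.eventually_ne one_ne_zero] with n hn hz
    simp [hz] at hn
  -- The scalars tend to infinity, since `c n * d n 0 → 1` while `d n 0 → 0`.
  have ht : Tendsto (fun n => (c n)⁻¹) l (𝓝 0) := by
    have h2 := hd0.div h0 one_ne_zero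
    rw [zero_div] at h2
    refine h2.congr' ?_
    filter_upwards [h0.eventually_ne one_ne_zero] with n hn
    simp only [Pi.div_apply]
    rw [mul_comm, div_mul_eq_div_div, div_self (right_ne_zero_of_mul hn), one_div]
  have key := taylorCoeff_mul_pow_eq_zero_of_tendsto (e := 1) (N := k) (i₀ := k) (j₀ := 0)
    (g := g) (x := P 0) (y := P 1) (m := m) (α := 1) (β := 0)
    (t := fun n => (c n)⁻¹) (s := fun n => d n 0) (u := fun n => d n 1 - m * d n 0) ht
    (hc.mono fun n hn => inv_ne_zero hn) (by simpa [mul_comm] using h0)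
    (by
      have h2 := h1.sub (h0.const_mul m)
      rw [mul_one, sub_self] at h2
      refine h2.congr fun n => ?_
      simp only [pow_one, div_inv_eq_mul]
      ring)
    (hmem.mono fun n hn => by
      rw [← hC _ hn, polyFun_eq_aeval]
      congr 3
      simp)
    (by simpa using hvan) (by simp) (by
      intro i j hij hne
      have : j ≠ 0 := by
        rintro rfl
        exact hne (by simp_all)
      simp [this])
  simpa using key

theorem tendsto_div_sq_of_deriv_deriv_eq_zero {γ : ℝ → Plane} (hγ : ContDiffAt ℝ 2 γ 0)
    (φ : Plane →L[ℝ] ℝ) (h1 : φ (deriv γ 0) = 0) (h2 : φ (deriv (deriv γ) 0) = 0) :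
    Tendsto (fun t => φ (γ t - γ 0) / t ^ 2) (𝓝[≠] 0) (𝓝 0) := by
  have hγ1 : ∀ᶠ t in 𝓝 (0 : ℝ), DifferentiableAt ℝ γ t :=
    (hγ.eventually (by simp)).mono fun t ht => ht.differentiableAt (by simp)
  have hγ2 : DifferentiableAt ℝ (deriv γ) 0 := by
    have : ContDiffAt ℝ 1 (fderiv ℝ γ) 0 := hγ.fderiv_right (by norm_num)
    exact (this.differentiableAt (by simp)).clm_apply (differentiableAt_const 1)
  have hd : HasDerivAt (fun t => φ (deriv γ t)) 0 0 := by
    have := φ.hasFDerivAt.comp_hasDerivAt (0 : ℝ) hγ2.hasDerivAt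
    rwa [h2] at this
  have hslope : Tendsto (fun t => φ (deriv γ t) / (2 * t)) (𝓝[≠] 0) (𝓝 0) := by
    have := (hasDerivAt_iff_tendsto_slope.1 hd).const_mul (1 / 2)
    rw [mul_zero] at this
    refine this.congr fun t => ?_
    simp only [slope_def_field, h1, sub_zero]
    field_simp
  refine HasDerivAt.lhopital_zero_nhdsNE (f' := fun t => φ (deriv γ t)) (g' := fun t => 2 * t)
    ?_ ?_ ?_ ?_ ?_ hslope
  · filter_upwards [hγ1.filter_mono nhdsWithin_le_nhds] with t ht
    exact φ.hasFDerivAt.comp_hasDerivAt t (ht.hasDerivAt.sub_const _)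
  · exact Eventually.of_forall fun t => by simpa using hasDerivAt_pow 2 t
  · filter_upwards [self_mem_nhdsWithin] with t ht
    simpa using ht
  · have : ContinuousAt (fun t => φ (γ t - γ 0)) 0 := by
      have := hγ.continuousAt
      fun_prop
    have h3 := this.tendsto.mono_left (nhdsWithin_le_nhds (s := {0}ᶜ))
    simpa using h3
  · have : Continuous fun t : ℝ => t ^ 2 := by fun_prop
    have h3 := (this.tendsto 0).mono_left (nhdsWithin_le_nhds (s := {0}ᶜ))
    simpa using h3

/-- A `C²` arc of the zero set cannot be transversal to `(1, m)`, because `U ^ k` is the leading form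
for the weights `(1, 1)`. If it is tangent to `(1, m)` and has zero curvature then `U` is `o(t ^ 2)`
on it, which the monomial `S ^ (2 k)` excludes. -/
theorem not_isInflectionPoint_of_taylorCoeff {g : MvPolynomial (Fin 2) ℝ} {C : Set Plane}
    (hC : ∀ p ∈ C, polyFun g p = 0) {P : Plane} {m : ℝ} {k : ℕ}
    (hk : taylorCoeff g (P 0) (P 1) m 0 k ≠ 0)
    (hvan : ∀ i j, i + 2 * j < 2 * k → taylorCoeff g (P 0) (P 1) m i j = 0)
    (h2k : taylorCoeff g (P 0) (P 1) m (2 * k) 0 ≠ 0) : ¬ IsInflectionPoint C P := by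
  rintro ⟨γ, hγ, h0, hmem, hγ', c, hγ''⟩
  -- The coordinates `S` and `U` of a vector.
  let φ : Plane →L[ℝ] ℝ := EuclideanSpace.proj 0
  let ψ : Plane →L[ℝ] ℝ := EuclideanSpace.proj 1 - m • EuclideanSpace.proj 0
  have hφ : ∀ p, φ p = p 0 := fun p => rfl
  have hψ : ∀ p, ψ p = p 1 - m * p 0 := fun p => rfl
  have hlim : ∀ χ : Plane →L[ℝ] ℝ,
      Tendsto (fun t => χ (γ t - γ 0) / t) (𝓝[≠] 0) (𝓝 (χ (deriv γ 0))) := fun χ => by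
    have h1 : HasDerivAt γ (deriv γ 0) 0 := (hγ.differentiableAt (by simp)).hasDerivAt
    have h2 := hasDerivAt_iff_tendsto_slope.1 (χ.hasFDerivAt.comp_hasDerivAt (0 : ℝ) h1)
    refine h2.congr fun t => ?_
    simp [slope_def_field]
  have ht : Tendsto (fun t : ℝ => t) (𝓝[≠] 0) (𝓝 0) := nhdsWithin_le_nhds
  have ht0 : ∀ᶠ t : ℝ in 𝓝[≠] 0, t ≠ 0 := self_mem_nhdsWithin
  have hzero : ∀ᶠ t in 𝓝[≠] (0 : ℝ), MvPolynomial.aeval ![P 0 + φ (γ t - γ 0),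
      P 1 + m * φ (γ t - γ 0) + ψ (γ t - γ 0)] g = (0 : ℝ) := by
    filter_upwards [hmem.filter_mono nhdsWithin_le_nhds] with t hm
    have hm' := hC _ hm
    rw [polyFun_eq_aeval] at hm'
    refine Eq.trans ?_ hm'
    rw [h0, hφ, hψ]
    simp
  by_cases hβ : ψ (deriv γ 0) = 0
  · have hα : φ (deriv γ 0) ≠ 0 := fun hα => hγ' <| by
      rw [hφ] at hα
      rw [hψ, hα, mul_zero, sub_zero] at hβ
      ext i
      fin_cases i
      · exact hα
      · exact hβ
    have key := taylorCoeff_mul_pow_eq_zero_of_tendsto (e := 2) (N := 2 * k) (i₀ := 2 * k)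
      (j₀ := 0) ht ht0 (hlim φ)
      (tendsto_div_sq_of_deriv_deriv_eq_zero hγ ψ hβ (by simp [hγ'', hβ])) hzero hvan (by simp)
      (by
        intro i j hij hne
        have : j ≠ 0 := by
          rintro rfl
          exact hne (by simp_all)
        simp [this])
    simp [h2k, hα] at key
  · have key := taylorCoeff_mul_pow_eq_zero_of_tendsto (e := 1) (N := k) (i₀ := 0)
      (j₀ := k) ht ht0 (hlim φ) (by simpa using hlim ψ) hzero
      (fun i j hij => hvan i j (by omega)) (by simp)
      (by
        intro i j hij hne
        have : i ≠ 0 := by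
          rintro rfl
          exact hne (by simp_all)
        rw [hvan i j (by omega)]
        simp)
    simp [hk, hβ] at key

/-! ### Germs of sequences of points of tangency -/

/-- The germ at a nonprincipal ultrafilter of a sequence of distinct reals is transcendental over
`ℝ`, so the field of germs has an `ℝ`-derivation taking the value `1` on it. -/
theorem exists_germ_field_derivation {m : ℕ → ℝ} (hm : Function.Injective m) :
    ∃ (K : Type) (_ : Field K) (_ : Algebra ℝ K) (φ : (ℕ → ℝ) →ₐ[ℝ] K) (D : Derivation ℝ K K),
      D (φ m) = 1 ∧ ∀ a, φ a = 0 ↔ ∀ᶠ n in (hyperfilter ℕ : Filter ℕ), a n = 0 := by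
  let K := Germ (hyperfilter ℕ : Filter ℕ) ℝ
  let ρ : (ℕ → ℝ) →+* K := Germ.coeRingHom _
  let _ : Algebra ℝ K := (ρ.comp (algebraMap ℝ (ℕ → ℝ))).toAlgebra
  let φ : (ℕ → ℝ) →ₐ[ℝ] K := { ρ with commutes' := fun _ => rfl }
  have hφ : ∀ a, φ a = 0 ↔ ∀ᶠ n in (hyperfilter ℕ : Filter ℕ), a n = 0 := fun a =>
    Germ.coe_eq (l := (hyperfilter ℕ : Filter ℕ)) (f := a) (g := 0)
  have htr : Transcendental ℝ (φ m) := by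
    rw [transcendental_iff]
    intro p hp
    have h1 : φ (fun n => p.eval (m n)) = 0 := by
      rw [← hp, aeval_algHom_apply]
      congr 1
      funext n
      simp
    by_contra hp0
    have hfin : {n | p.eval (m n) = 0}.Finite := by
      refine (p.roots.toFinset.finite_toSet.preimage hm.injOn).subset fun n hn => ?_
      simpa [hp0] using hn
    exact (hfin.notMem_hyperfilter) ((hφ _).1 h1)
  obtain ⟨D, hD⟩ := exists_derivation_eq_one_of_transcendental htr
  exact ⟨K, inferInstance, inferInstance, φ, D, hD, hφ⟩

theorem taylorCoeff_pi (g : MvPolynomial (Fin 2) ℝ) (x y m : ℕ → ℝ) (i j n : ℕ) :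
    taylorCoeff g x y m i j n = taylorCoeff g (x n) (y n) (m n) i j :=
  (taylorCoeff_map (Pi.evalAlgHom ℝ (fun _ : ℕ => ℝ) n) g x y m i j).symm

section
variable {K : Type} [Field K] [Algebra ℝ K] {φ : (ℕ → ℝ) →ₐ[ℝ] K} {D : Derivation ℝ K K}
  {m : ℕ → ℝ} {g : MvPolynomial (Fin 2) ℝ} {C : Set Plane} {P : ℕ → Plane}

theorem taylorCoeff_germ_eq_zero_iff
    (hφ : ∀ a, φ a = 0 ↔ ∀ᶠ n in (hyperfilter ℕ : Filter ℕ), a n = 0) (x y : ℕ → ℝ) (i j : ℕ) :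
    taylorCoeff g (φ x) (φ y) (φ m) i j = 0 ↔
      ∀ᶠ n in (hyperfilter ℕ : Filter ℕ), taylorCoeff g (x n) (y n) (m n) i j = 0 := by
  simp only [taylorCoeff_map, hφ, taylorCoeff_pi]

theorem eventually_taylorCoeff_eq_zero
    (hφ : ∀ a, φ a = 0 ↔ ∀ᶠ n in (hyperfilter ℕ : Filter ℕ), a n = 0) {x y : ℕ → ℝ} {e N : ℕ}
    (he : 1 ≤ e) (h : ∀ i j, i + e * j < N → taylorCoeff g (φ x) (φ y) (φ m) i j = 0) :
    ∀ᶠ n in (hyperfilter ℕ : Filter ℕ), ∀ i j, i + e * j < N →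
      taylorCoeff g (x n) (y n) (m n) i j = 0 := by
  have hfin : {p : ℕ × ℕ | p.1 + e * p.2 < N}.Finite := by
    refine ((Set.finite_lt_nat N).prod (Set.finite_lt_nat N)).subset ?_
    rintro ⟨i, j⟩ hij
    have hj : j ≤ e * j := Nat.le_mul_of_pos_left j he
    simp only [Set.mem_ofPred_eq] at hij
    exact ⟨by simp only [Set.mem_ofPred_eq]; omega, by simp only [Set.mem_ofPred_eq]; omega⟩
  filter_upwards [(eventually_all_finite hfin).2 fun p hp =>
    (taylorCoeff_germ_eq_zero_iff hφ x y p.1 p.2).1 (h _ _ hp)] with n hn i j hij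
  exact hn (i, j) hij

/-- At the germ of a sequence of points with tangent slopes `m n`, the point moves along `D` in the
direction `(1, m)`. -/
theorem exists_order_of_mem_tangentConeAt
    (hφ : ∀ a, φ a = 0 ↔ ∀ᶠ n in (hyperfilter ℕ : Filter ℕ), a n = 0) (hD : D (φ m) = 1)
    (hg : g ≠ 0) (hC : ∀ p ∈ C, polyFun g p = 0)
    (hP : ∀ n, !₂[1, m n] ∈ tangentConeAt ℝ C (P n)) :
    D (φ fun n => P n 1) = φ m * D (φ fun n => P n 0) ∧ D (φ fun n => P n 0) ≠ 0 ∧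
      ∃ k, (∀ i j, i + j < k →
          taylorCoeff g (φ fun n => P n 0) (φ fun n => P n 1) (φ m) i j = 0) ∧
        ∃ i j, i + j = k ∧
          taylorCoeff g (φ fun n => P n 0) (φ fun n => P n 1) (φ m) i j ≠ 0 := by
  classical
  have hex : ∃ k i j, i + j = k ∧
      taylorCoeff g (φ fun n => P n 0) (φ fun n => P n 1) (φ m) i j ≠ 0 := by
    obtain ⟨i, j, h⟩ := exists_taylorCoeff_ne_zero hg (φ fun n => P n 0) (φ fun n => P n 1) (φ m)
    exact ⟨i + j, i, j, rfl, h⟩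
  have hvan : ∀ i j, i + j < Nat.find hex →
      taylorCoeff g (φ fun n => P n 0) (φ fun n => P n 1) (φ m) i j = 0 := fun i j hij => by
    by_contra h
    exact Nat.find_min hex hij ⟨i, j, rfl, h⟩
  have hk : taylorCoeff g (φ fun n => P n 0) (φ fun n => P n 1) (φ m) (Nat.find hex) 0 = 0 := by
    rw [taylorCoeff_germ_eq_zero_iff hφ]
    filter_upwards [eventually_taylorCoeff_eq_zero hφ (e := 1) (N := Nat.find hex) le_rfl
      fun i j hij => hvan i j (by omega)] with n hn
    exact taylorCoeff_eq_zero_of_mem_tangentConeAt hC (hP n) fun i j hij => hn i j (by omega)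
  obtain ⟨h1, h2⟩ := derivation_eq_mul_and_ne_zero hD hvan hk (Nat.find_spec hex)
  exact ⟨h1, h2, _, hvan, Nat.find_spec hex⟩
end

theorem finite_slopes_of_tangent_at_two_points {g : MvPolynomial (Fin 2) ℝ} (hg : g ≠ 0)
    {C : Set Plane} (hC : ∀ p ∈ C, polyFun g p = 0) :
    {m : ℝ | ∃ P Q : Plane, P ≠ Q ∧ !₂[1, m] ∈ tangentConeAt ℝ C P ∧
      !₂[1, m] ∈ tangentConeAt ℝ C Q ∧ P 1 - m * P 0 = Q 1 - m * Q 0}.Finite := by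
  by_contra hinf
  let e := Set.Infinite.natEmbedding _ hinf
  let m : ℕ → ℝ := fun n => e n
  have hm : Function.Injective m := Subtype.val_injective.comp e.injective
  choose P Q hPQ hP hQ hline using fun n => (e n).2
  obtain ⟨K, _, _, φ, D, hD, hφ⟩ := exists_germ_field_derivation hm
  obtain ⟨hP1, -⟩ := exists_order_of_mem_tangentConeAt hφ hD hg hC hP
  obtain ⟨hQ1, -⟩ := exists_order_of_mem_tangentConeAt hφ hD hg hC hQ
  have hb : (φ fun n => P n 1) - φ m * (φ fun n => P n 0) =
      (φ fun n => Q n 1) - φ m * (φ fun n => Q n 0) := by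
    rw [← map_mul, ← map_mul, ← map_sub, ← map_sub]
    congr 1
    funext n
    exact hline n
  -- Differentiating the intercept `b` of the common line gives `x = -D b` at both points.
  have hDb := congrArg D hb
  simp only [map_sub, Derivation.leibniz, smul_eq_mul, hP1, hQ1, hD] at hDb
  have hx : (φ fun n => P n 0) = φ fun n => Q n 0 := by linear_combination -hDb
  have hx' := (hφ _).1
    (show φ ((fun n => P n 0) - fun n => Q n 0) = 0 by rw [map_sub, hx, sub_self])
  obtain ⟨n, hn⟩ := hx'.exists
  have h0 : P n 0 = Q n 0 := sub_eq_zero.1 hn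
  apply hPQ n
  ext i
  fin_cases i
  · exact h0
  · have := hline n
    rw [h0] at this
    simpa using this

theorem finite_slopes_of_tangent_at_inflectionPoint {g : MvPolynomial (Fin 2) ℝ} (hg : g ≠ 0)
    {C : Set Plane} (hC : ∀ p ∈ C, polyFun g p = 0) :
    {m : ℝ | ∃ P : Plane, IsInflectionPoint C P ∧ !₂[1, m] ∈ tangentConeAt ℝ C P}.Finite := by
  by_contra hinf
  let e := Set.Infinite.natEmbedding _ hinf
  let m : ℕ → ℝ := fun n => e n
  have hm : Function.Injective m := Subtype.val_injective.comp e.injective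
  choose P hinfl hP using fun n => (e n).2
  obtain ⟨K, _, _, φ, D, hD, hφ⟩ := exists_germ_field_derivation hm
  obtain ⟨h1, h2, k, hvan, hne⟩ := exists_order_of_mem_tangentConeAt hφ hD hg hC hP
  obtain ⟨h3, h4, h5⟩ := taylorCoeff_of_derivation_eq_mul hD h1 h2 hvan hne
  have h4' := eventually_taylorCoeff_eq_zero hφ one_le_two h4
  rw [Ne, taylorCoeff_germ_eq_zero_iff hφ, ← Ultrafilter.eventually_not] at h3 h5
  obtain ⟨n, hn3, hn4, hn5⟩ := (h3.and (h4'.and h5)).exists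
  exact not_isInflectionPoint_of_taylorCoeff hC hn3 hn4 hn5 (hinfl n)

/-! ### From slopes to directions, and the level curve -/

theorem smul_mem_tangentConeAt {C : Set Plane} {P v : Plane} (hv : v ∈ tangentConeAt ℝ C P)
    (a : ℝ) : a • v ∈ tangentConeAt ℝ C P := by
  obtain ⟨α, l, hl, c, d, hd, hmem, hcd⟩ := exists_fun_of_mem_tangentConeAt hv
  exact mem_tangentConeAt_of_seq l (fun n => a * c n) d hd hmem
    (by simpa only [mul_smul] using hcd.const_smul a)

theorem mk_slope_ne_zero (m : ℝ) : (!₂[1, m] : Plane) ≠ 0 := fun h => by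
  simpa using congrArg (fun p : Plane => p 0) h

theorem mem_tangentConeAt_of_direction_eq {C : Set Plane} {P : Plane} {m : ℝ}
    {L : AffineSubspace ℝ Plane} (hL : IsTangentLineAt C P L)
    (hd : L.direction = (Projectivization.mk ℝ _ (mk_slope_ne_zero m)).submodule) :
    !₂[1, m] ∈ tangentConeAt ℝ C P ∧ L = AffineSubspace.mk' P (ℝ ∙ !₂[1, m]) := by
  obtain ⟨-, v, hv, -, rfl⟩ := hL
  rw [AffineSubspace.direction_mk', Projectivization.submodule_mk] at hd
  have hmem : (!₂[1, m] : Plane) ∈ ℝ ∙ v := hd ▸ Submodule.mem_span_singleton_self _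
  obtain ⟨a, ha⟩ := Submodule.mem_span_singleton.1 hmem
  exact ⟨ha ▸ smul_mem_tangentConeAt hv a, by rw [hd]⟩

/-- The finiteness holds for every subset of a real algebraic curve, reduced or not. -/
theorem finite_not_isGenericDirection {g : MvPolynomial (Fin 2) ℝ} (hg : g ≠ 0)
    {C : Set Plane} (hC : ∀ p ∈ C, polyFun g p = 0) :
    {d : ProjDirection | ¬ IsGenericDirection C d}.Finite := by
  have hvert : (!₂[0, 1] : Plane) ≠ 0 := fun h => by
    simpa using congrArg (fun p : Plane => p 1) h
  -- The vertical direction is the only one without a slope.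
  refine ((((finite_slopes_of_tangent_at_two_points hg hC).union
    (finite_slopes_of_tangent_at_inflectionPoint hg hC)).image
      fun m => Projectivization.mk ℝ _ (mk_slope_ne_zero m)).insert
        (Projectivization.mk ℝ _ hvert)).subset ?_
  intro d hd
  induction d using Projectivization.ind with | _ v hv
  by_cases hv0 : v 0 = 0
  · left
    have hv1 : v 1 ≠ 0 := fun h => hv <| by
      ext i
      fin_cases i
      · exact hv0
      · exact h
    rw [Projectivization.mk_eq_mk_iff']
    refine ⟨v 1, ?_⟩
    ext i
    fin_cases i <;> simp [hv0]
  right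
  have hslope : Projectivization.mk ℝ _ (mk_slope_ne_zero (v 1 / v 0)) =
      Projectivization.mk ℝ v hv := by
    rw [Projectivization.mk_eq_mk_iff']
    refine ⟨(v 0)⁻¹, ?_⟩
    ext i
    fin_cases i
    · simp [hv0]
    · simp [div_eq_inv_mul]
  refine ⟨v 1 / v 0, ?_, hslope⟩
  rw [← hslope] at hd
  simp only [IsGenericDirection, Set.mem_ofPred_eq, not_and_or, not_forall, not_not] at hd
  rcases hd with ⟨L, ⟨P, Q, hPQ, hP, hQ⟩, hL⟩ | ⟨P, L, hP, hPL, hL⟩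
  · left
    obtain ⟨hP1, hP2⟩ := mem_tangentConeAt_of_direction_eq hP hL
    obtain ⟨hQ1, hQ2⟩ := mem_tangentConeAt_of_direction_eq hQ hL
    refine ⟨P, Q, hPQ, hP1, hQ1, ?_⟩
    have hPmem : P ∈ AffineSubspace.mk' Q (ℝ ∙ (!₂[1, v 1 / v 0] : Plane)) := by
      rw [← hQ2, hP2]
      exact AffineSubspace.self_mem_mk' _ _
    rw [AffineSubspace.mem_mk', Submodule.mem_span_singleton] at hPmem
    obtain ⟨a, ha⟩ := hPmem
    have h0 := congrArg (fun p : Plane => p 0) ha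
    have h1 := congrArg (fun p : Plane => p 1) ha
    simp at h0 h1
    rw [h0] at h1
    linear_combination -h1
  · exact Or.inr ⟨P, hP, (mem_tangentConeAt_of_direction_eq hPL hL).1⟩

theorem continuous_polyFun (f : MvPolynomial (Fin 2) ℝ) : Continuous (polyFun f) :=
  (MvPolynomial.continuous_eval f).comp (by fun_prop)

theorem polyFun_mem_of_mem_levelCurve {f : MvPolynomial (Fin 2) ℝ} {ε : ℝ} {p : Plane}
    (hp : p ∈ levelCurve f ε) : polyFun f p = 0 ∨ polyFun f p = ε := by
  obtain ⟨hpD, hpint⟩ := hp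
  have hmem := connectedComponentIn_subset _ _ hpD
  by_contra! h
  have hIoo : polyFun f p ∈ Set.Ioo 0 ε :=
    ⟨lt_of_le_of_ne hmem.1 (Ne.symm h.1), lt_of_le_of_ne hmem.2 h.2⟩
  obtain ⟨r, hr, hball⟩ := Metric.isOpen_iff.1
    (isOpen_Ioo.preimage (continuous_polyFun f)) p hIoo
  apply hpint
  rw [mem_interior_iff_mem_nhds]
  refine mem_of_superset (Metric.ball_mem_nhds p hr) ?_
  unfold sublevelComponent at hpD ⊢
  rw [connectedComponentIn_eq hpD]
  exact (convex_ball p r).isPreconnected.subset_connectedComponentIn (Metric.mem_ball_self hr)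
    (hball.trans (Set.preimage_mono Set.Ioo_subset_Icc_self))

end

theorem theorem2p8 (f : MvPolynomial (Fin 2) ℝ) (hf0 : polyFun f 0 = 0)
    (hfmin : HasStrictLocalMinAtOrigin f) (ε : ℝ) (hε : 0 < ε) :
    {d : ProjDirection | ¬ IsGenericDirection (levelCurve f ε) d}.Finite := by
  have hf : f ≠ 0 := by
    rintro rfl
    obtain ⟨p, hp⟩ := hfmin.exists
    simp [polyFun] at hp
  have hfε : f - MvPolynomial.C ε ≠ 0 := by
    intro h
    have h0 : polyFun (f - MvPolynomial.C ε) 0 = 0 := by rw [h]; simp [polyFun]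
    have h1 : polyFun (f - MvPolynomial.C ε) 0 = polyFun f 0 - ε := by simp [polyFun]
    rw [h1, hf0] at h0
    linarith
  refine finite_not_isGenericDirection (mul_ne_zero hf hfε) fun p hp => ?_
  have h1 : polyFun (f * (f - MvPolynomial.C ε)) p = polyFun f p * (polyFun f p - ε) := by
    simp [polyFun]
  rcases polyFun_mem_of_mem_levelCurve hp with h | h <;> simp [h1, h]
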